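/- For real $\sigma,\delta$ and $t>0$ put $s=\sigma+it$, $\bar s=\sigma-it$, $T=t/(2\pi)$, let $[T]$ be the integer part of $T$, and define $$S_2(\sigma,t,\delta)=\sum_{\substack{m_1\in\mathbb N\\ t^{1-\delta}\le m_1\le [T]}}\ \sum_{\substack{m_2\in\mathbb N\\ 1\le m_2<\frac{m_1}{t^{1-\delta}-1}}}\frac{1}{m_1^{s}\,(m_1+m_2)^{\bar s}} .$$ Then, for all sufficiently small $\delta>0$ (that is, there is an absolute constant $\delta_0>0$ such that the following holds for all $0<\delta<\delta_0$) and every $\sigma$ with $0<\sigma<1$, $$S_2(\sigma,t,\delta)=O\!\left(t^{1-2\sigma+2\delta\sigma}(\ln t)^3\right)+O\!\left(\frac{t^{\delta}}{t^{2\sigma}}\right),\qquad t\to\infty ,$$ where the implied constants may depend on $\sigma$ and $\delta$. -/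

import Mathlib

open Filter Asymptotics

/-- The double sum `S₂(σ, t, δ) = ∑_{t^{1-δ} ≤ m₁ ≤ [T]} ∑_{1 ≤ m₂ < m₁ / (t^{1-δ} - 1)}
m₁^{-s} (m₁ + m₂)^{-s̄}` with `s = σ + i t` and `T = t / (2π)`, over integers `m₁`, `m₂`.
By `Nat.ceil_le`, `m₁` runs over the integers with `t^{1-δ} ≤ m₁ ≤ [T]`; by `Nat.lt_ceil`,
`m₂` runs over the integers with `1 ≤ m₂ < m₁ / (t^{1-δ} - 1)`. -/
noncomputable def doubleSumS₂ (σ t δ : ℝ) : ℂ :=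
  ∑ m₁ ∈ Finset.Icc ⌈t ^ (1 - δ)⌉₊ ⌊t / (2 * Real.pi)⌋₊,
    ∑ m₂ ∈ Finset.Ico 1 ⌈(m₁ : ℝ) / (t ^ (1 - δ) - 1)⌉₊,
      1 / ((m₁ : ℂ) ^ ((σ : ℂ) + t * Complex.I) *
        ((m₁ : ℂ) + (m₂ : ℂ)) ^ (starRingEnd ℂ ((σ : ℂ) + t * Complex.I)))

/-! Interchange the sums and fix `m = m₂`. The sum over `n = m₁` has weight about `n ^ (-2σ)` and
phase `t * log (1 + m / n)`, whose step `t * logStep m n` has size about `t * m / n ^ 2`. On the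
range of summation `n ≥ t ^ (1 - δ)` and `n > m * (t ^ (1 - δ) - 1)`, so `t * m ≤ n ^ 2`: the step
is at most one and there is no resonance. Summation by parts in the manner of Kusmin and Landau
(`norm_sum_mul_sub_le`, `partsCoeff`) then gives `t ^ (1 - 2σ) * (1 + log t) / m` for the inner sum
(`norm_sum_weight_oscFactor_le`), and the harmonic sum over `m` costs one more logarithm. This is
stronger than the claim, so the second error term can be zero. -/

/-! ### Size and variation of the phase step. -/

/-- The quotient of consecutive values of `1 + m / x`, minus one. -/
noncomputable def ratioExcess (m x : ℝ) : ℝ := m / (x * (x + m + 1))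

/-- The decrease of `log (1 + m / x)` when `x` grows by one. -/
noncomputable def logStep (m x : ℝ) : ℝ := Real.log (1 + ratioExcess m x)

lemma logStep_eq {m x : ℝ} (hm : 0 < m) (hx : 0 < x) :
    logStep m x = (Real.log (x + m) - Real.log x) - (Real.log (x + 1 + m) - Real.log (x + 1)) := by
  have h : 1 + ratioExcess m x = ((x + m) / x) / ((x + 1 + m) / (x + 1)) := by
    unfold ratioExcess
    field_simp
    ring
  rw [logStep, h, Real.log_div (by positivity) (by positivity),
    Real.log_div (by positivity) (by positivity), Real.log_div (by positivity) (by positivity)]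

lemma ratioExcess_pos {m x : ℝ} (hm : 0 < m) (hx : 0 < x) : 0 < ratioExcess m x := by
  unfold ratioExcess
  positivity

lemma ratioExcess_le {m x : ℝ} (hm : 0 < m) (hx : 0 < x) : ratioExcess m x ≤ m / x ^ 2 := by
  unfold ratioExcess
  gcongr
  nlinarith

lemma logStep_le {m x : ℝ} (hm : 0 < m) (hx : 0 < x) : logStep m x ≤ m / x ^ 2 := by
  have h := ratioExcess_pos hm hx
  have := Real.log_le_sub_one_of_pos (show 0 < 1 + ratioExcess m x by linarith)
  have := ratioExcess_le hm hx
  unfold logStep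
  linarith

/-- Since `x + m + 1 ≤ 3 * x`, the excess `u` is at least `m / (3 * x ^ 2)`, and `log (1 + u) ≥ 2u /
(u + 2) ≥ u / 2` for `u ≤ 1`. -/
lemma le_logStep {m x : ℝ} (hm : 0 < m) (hx : 1 ≤ x) (hmx : m ≤ x) :
    m / (6 * x ^ 2) ≤ logStep m x := by
  have hx0 : 0 < x := by linarith
  have h := ratioExcess_pos hm hx0
  have h1 : ratioExcess m x ≤ 1 := by
    refine (ratioExcess_le hm hx0).trans ?_
    rw [div_le_one (by positivity)]
    nlinarith
  have h3 : m / (3 * x ^ 2) ≤ ratioExcess m x := by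
    unfold ratioExcess
    exact div_le_div_of_nonneg_left hm.le (by positivity) (by nlinarith)
  have h2 : ratioExcess m x / 2 ≤ 2 * ratioExcess m x / (ratioExcess m x + 2) := by
    rw [div_le_div_iff₀ (by norm_num) (by linarith)]
    nlinarith
  calc m / (6 * x ^ 2) = m / (3 * x ^ 2) / 2 := by field_simp; norm_num
    _ ≤ ratioExcess m x / 2 := by gcongr
    _ ≤ _ := h2.trans (Real.le_log_one_add_of_nonneg h.le)

lemma abs_logStep_sub_le {m x : ℝ} (hm : 0 < m) (hx : 1 ≤ x) (hmx : m ≤ x) :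
    |logStep m x - logStep m (x + 1)| ≤ 5 * m / x ^ 3 := by
  have hx0 : 0 < x := by linarith
  have hu := ratioExcess_pos hm hx0
  have hv := ratioExcess_pos hm (show 0 < x + 1 by linarith)
  have hdiff : ratioExcess m x - ratioExcess m (x + 1)
      = m * (2 * x + m + 2) / (x * (x + 1) * (x + m + 1) * (x + m + 2)) := by
    unfold ratioExcess
    have : x + 1 + m + 1 ≠ 0 := by positivity
    field_simp
    ring
  have hle : ratioExcess m x - ratioExcess m (x + 1) ≤ 5 * m / x ^ 3 := by
    rw [hdiff]
    calc m * (2 * x + m + 2) / (x * (x + 1) * (x + m + 1) * (x + m + 2))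
        ≤ m * (5 * x) / (x * x * x * x) := by
          gcongr <;> linarith
      _ = 5 * m / x ^ 3 := by field_simp
  have hvu : ratioExcess m (x + 1) ≤ ratioExcess m x := by
    have : 0 ≤ ratioExcess m x - ratioExcess m (x + 1) := by rw [hdiff]; positivity
    linarith
  have hmono : logStep m (x + 1) ≤ logStep m x :=
    Real.log_le_log (by linarith) (by linarith)
  rw [abs_of_nonneg (by linarith)]
  refine le_trans ?_ hle
  unfold logStep
  rw [← Real.log_div (by linarith) (by linarith)]
  refine (Real.log_le_sub_one_of_pos (by positivity)).trans ?_
  rw [div_sub_one (by linarith), div_le_iff₀ (by linarith)]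
  nlinarith

/-! ### Chord bounds on the unit circle and summation by parts. -/

lemma half_abs_le_norm_exp_sub_one {y : ℝ} (hy : |y| ≤ 1) :
    |y| / 2 ≤ ‖Complex.exp (Complex.I * y) - 1‖ := by
  have hnn := abs_nonneg y
  rw [Complex.norm_exp_I_mul_ofReal_sub_one, Real.norm_eq_abs, abs_mul, abs_two,
    Real.abs_sin_eq_sin_abs_of_abs_le_pi, abs_div, abs_two]
  · have h := Real.mul_le_sin (x := |y| / 2) (by positivity) (by linarith [Real.pi_gt_three])
    have hpi : 1 / 2 ≤ 2 / Real.pi := by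
      rw [div_le_div_iff₀ (by norm_num) Real.pi_pos]
      linarith [Real.pi_lt_four]
    nlinarith
  · rw [abs_div, abs_two]
    linarith [Real.pi_gt_three]

lemma norm_exp_sub_exp_le (x y : ℝ) :
    ‖Complex.exp (Complex.I * x) - Complex.exp (Complex.I * y)‖ ≤ |x - y| := by
  have h : Complex.exp (Complex.I * x) - Complex.exp (Complex.I * y)
      = Complex.exp (Complex.I * y) * (Complex.exp (Complex.I * ((x - y : ℝ) : ℂ)) - 1) := by
    rw [mul_sub, ← Complex.exp_add]
    push_cast
    ring_nf
  rw [h, norm_mul, Complex.norm_exp_I_mul_ofReal, one_mul]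
  exact Real.norm_exp_I_mul_ofReal_sub_one_le

/-- Summation by parts against a sequence bounded by one. -/
lemma norm_sum_mul_sub_le (h z : ℕ → ℂ) (hz : ∀ n, ‖z n‖ ≤ 1) {B M : ℕ} (hBM : B ≤ M) :
    ‖∑ n ∈ Finset.Ico B M, h n * (z (n + 1) - z n)‖
      ≤ ‖h M‖ + ‖h B‖ + ∑ n ∈ Finset.Ico B M, ‖h (n + 1) - h n‖ := by
  have key : ∑ n ∈ Finset.Ico B M, h n * (z (n + 1) - z n)
      = h M * z M - h B * z B - ∑ n ∈ Finset.Ico B M, (h (n + 1) - h n) * z (n + 1) := by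
    rw [← Finset.sum_Ico_sub (fun n => h n * z n) hBM, ← Finset.sum_sub_distrib]
    exact Finset.sum_congr rfl fun n _ => by ring
  have hb : ∀ (c : ℂ) n, ‖c * z n‖ ≤ ‖c‖ := fun c n => by
    rw [norm_mul]
    exact mul_le_of_le_one_right (norm_nonneg _) (hz n)
  rw [key]
  refine (norm_sub_le _ _).trans (add_le_add ((norm_sub_le _ _).trans
    (add_le_add (hb _ _) (hb _ _))) ((norm_sum_le _ _).trans
    (Finset.sum_le_sum fun n _ => hb _ _)))

/-! ### Size and variation of the weight. -/

/-- The modulus of the summand of `doubleSumS₂`. -/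
noncomputable def weight (σ m x : ℝ) : ℝ := x ^ (-σ) * (x + m) ^ (-σ)

lemma weight_nonneg {σ m x : ℝ} (hm : 0 < m) (hx : 0 < x) : 0 ≤ weight σ m x := by
  unfold weight
  positivity

lemma weight_le {σ m x : ℝ} (hσ : 0 < σ) (hm : 0 < m) (hx : 0 < x) :
    weight σ m x ≤ x ^ (-(2 * σ)) := by
  have h : (x + m) ^ (-σ) ≤ x ^ (-σ) :=
    Real.rpow_le_rpow_of_nonpos hx (by linarith) (by linarith)
  calc weight σ m x ≤ x ^ (-σ) * x ^ (-σ) := by unfold weight; gcongr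
    _ = x ^ (-(2 * σ)) := by rw [← Real.rpow_add hx]; ring_nf

lemma weight_succ_le {σ m x : ℝ} (hσ : 0 < σ) (hm : 0 < m) (hx : 0 < x) :
    weight σ m (x + 1) ≤ weight σ m x := by
  unfold weight
  gcongr ?_ * ?_
  · exact Real.rpow_le_rpow_of_nonpos hx (by linarith) (by linarith)
  · exact Real.rpow_le_rpow_of_nonpos (by linarith) (by linarith) (by linarith)

lemma mul_rpow_neg_le_rpow_neg_add_one {σ y : ℝ} (hσ : σ ≤ 1) (hy : 0 < y) :
    y / (y + 1) * y ^ (-σ) ≤ (y + 1) ^ (-σ) := by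
  have h1 : y / (y + 1) ≤ (y / (y + 1)) ^ σ := by
    conv_lhs => rw [← Real.rpow_one (y / (y + 1))]
    exact Real.rpow_le_rpow_of_exponent_ge (by positivity)
      (by rw [div_le_one (by linarith)]; linarith) hσ
  calc y / (y + 1) * y ^ (-σ) ≤ (y / (y + 1)) ^ σ * y ^ (-σ) := by gcongr
    _ = (y + 1) ^ (-σ) := by
      rw [Real.div_rpow hy.le (by linarith), Real.rpow_neg hy.le, Real.rpow_neg (by linarith)]
      have : y ^ σ ≠ 0 := by positivity
      field_simp

/-- Each of the two powers shrinks by a factor of at least `x / (x + 1)`, and `(x / (x + 1)) ^ 2 ≥ 1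
- 2 / x`. -/
lemma abs_weight_sub_le {σ m x : ℝ} (hσ : 0 < σ) (hσ1 : σ ≤ 1) (hm : 0 < m) (hx : 0 < x) :
    |weight σ m (x + 1) - weight σ m x| ≤ 2 * weight σ m x / x := by
  have hw := weight_nonneg (σ := σ) hm hx
  have h1 := mul_rpow_neg_le_rpow_neg_add_one hσ1 hx
  have h2 := mul_rpow_neg_le_rpow_neg_add_one hσ1 (show 0 < x + m by linarith)
  have h3 : x / (x + 1) * (x + m) ^ (-σ) ≤ (x + m + 1) ^ (-σ) := by
    refine le_trans ?_ h2
    gcongr ?_ * _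
    rw [div_le_div_iff₀ (by linarith) (by linarith)]
    nlinarith
  have h4 : (x / (x + 1)) ^ 2 * weight σ m x ≤ weight σ m (x + 1) := by
    have := mul_le_mul h1 h3 (by positivity) (by positivity)
    unfold weight
    rw [add_right_comm x 1 m]
    calc _ = _ := by ring
      _ ≤ _ := this
  have h5 : 1 - 2 / x ≤ (x / (x + 1)) ^ 2 := by
    have h6 : x / (x + 1) = 1 - 1 / (x + 1) := by field_simp; ring
    have h7 : 1 / (x + 1) ≤ 1 / x := by gcongr; linarith
    have h8 : 2 / x = 2 * (1 / x) := by ring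
    rw [h6]
    nlinarith [sq_nonneg (1 / (x + 1))]
  rw [abs_sub_comm, abs_of_nonneg (by linarith [weight_succ_le hσ hm hx])]
  have h9 : 2 * weight σ m x / x = 2 / x * weight σ m x := by ring
  rw [h9]
  nlinarith

/-! ### The reciprocal increment. -/

/-- The reciprocal of the relative increment of the oscillating factor. -/
noncomputable def recipIncrement (t m x : ℝ) : ℂ :=
  (Complex.exp (Complex.I * ((-(t * logStep m x) : ℝ) : ℂ)) - 1)⁻¹

section Increment

variable {t m x : ℝ}

lemma le_norm_increment (ht : 0 < t) (hm : 0 < m) (hx : 1 ≤ x) (hmx : m ≤ x)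
    (htx : t * m ≤ x ^ 2) :
    t * m / (12 * x ^ 2) ≤
      ‖Complex.exp (Complex.I * ((-(t * logStep m x) : ℝ) : ℂ)) - 1‖ := by
  have hx0 : 0 < x := by linarith
  have h1 := le_logStep hm hx hmx
  have h2 := logStep_le hm hx0
  have h0 : 0 ≤ logStep m x := le_trans (by positivity) h1
  have habs : |(-(t * logStep m x))| = t * logStep m x := by
    rw [abs_neg, abs_of_nonneg (by positivity)]
  refine le_trans ?_ (half_abs_le_norm_exp_sub_one ?_)
  · rw [habs]
    calc t * m / (12 * x ^ 2) = t * (m / (6 * x ^ 2)) / 2 := by field_simp; norm_num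
      _ ≤ _ := by gcongr
  · rw [habs]
    calc t * logStep m x ≤ t * (m / x ^ 2) := by gcongr
      _ ≤ 1 := by rw [← mul_div_assoc, div_le_one (by positivity)]; exact htx

lemma increment_ne_zero (ht : 0 < t) (hm : 0 < m) (hx : 1 ≤ x) (hmx : m ≤ x)
    (htx : t * m ≤ x ^ 2) :
    Complex.exp (Complex.I * ((-(t * logStep m x) : ℝ) : ℂ)) - 1 ≠ 0 := by
  rw [← norm_pos_iff]
  exact lt_of_lt_of_le (by positivity) (le_norm_increment ht hm hx hmx htx)

lemma norm_recipIncrement_le (ht : 0 < t) (hm : 0 < m) (hx : 1 ≤ x) (hmx : m ≤ x)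
    (htx : t * m ≤ x ^ 2) :
    ‖recipIncrement t m x‖ ≤ 12 * x ^ 2 / (t * m) := by
  have hx0 : 0 < x := by linarith
  rw [recipIncrement, norm_inv, ← inv_div]
  exact inv_anti₀ (by positivity) (le_norm_increment ht hm hx hmx htx)

/-- By `1/a - 1/b = (b - a) / (a * b)`, the small variation of the step saves a factor `x` over the
size bound. -/
lemma norm_recipIncrement_sub_le (ht : 0 < t) (hm : 0 < m) (hx : 1 ≤ x) (hmx : m ≤ x)
    (htx : t * m ≤ x ^ 2) :
    ‖recipIncrement t m (x + 1) - recipIncrement t m x‖ ≤ 2880 * x / (t * m) := by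
  have hx0 : 0 < x := by linarith
  have hmx' : m ≤ x + 1 := by linarith
  have htx' : t * m ≤ (x + 1) ^ 2 := by nlinarith
  have hx' : 1 ≤ x + 1 := by linarith
  have hne := increment_ne_zero ht hm hx hmx htx
  have hne' := increment_ne_zero ht hm hx' hmx' htx'
  have hn := norm_recipIncrement_le ht hm hx hmx htx
  have hn' := norm_recipIncrement_le ht hm hx' hmx' htx'
  have hd : ‖Complex.exp (Complex.I * ((-(t * logStep m x) : ℝ) : ℂ))
      - Complex.exp (Complex.I * ((-(t * logStep m (x + 1)) : ℝ) : ℂ))‖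
      ≤ t * (5 * m / x ^ 3) := by
    refine (norm_exp_sub_exp_le _ _).trans ?_
    rw [show -(t * logStep m x) - -(t * logStep m (x + 1))
      = -(t * (logStep m x - logStep m (x + 1))) by ring, abs_neg, abs_mul, abs_of_pos ht]
    gcongr
    exact abs_logStep_sub_le hm hx hmx
  have heq : recipIncrement t m (x + 1) - recipIncrement t m x
      = (Complex.exp (Complex.I * ((-(t * logStep m x) : ℝ) : ℂ))
      - Complex.exp (Complex.I * ((-(t * logStep m (x + 1)) : ℝ) : ℂ)))
      * recipIncrement t m x * recipIncrement t m (x + 1) := by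
    unfold recipIncrement
    field_simp
    ring
  rw [heq, norm_mul, norm_mul]
  calc _ ≤ t * (5 * m / x ^ 3) * (12 * x ^ 2 / (t * m)) * (12 * (x + 1) ^ 2 / (t * m)) := by
        gcongr
    _ ≤ t * (5 * m / x ^ 3) * (12 * x ^ 2 / (t * m)) * (12 * (2 * x) ^ 2 / (t * m)) := by
        gcongr
        linarith
    _ = 2880 * x / (t * m) := by field_simp; norm_num

end Increment

/-! ### Coefficients of the summation by parts. -/

/-- The coefficient of the differences in the summation by parts. -/
noncomputable def partsCoeff (σ t m x : ℝ) : ℂ := (weight σ m x : ℂ) * recipIncrement t m x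

section PartsCoeff

variable {σ t m x : ℝ}

/-- The exponent `2 - 2σ` is positive, so the worst case is `x = t`. -/
lemma rpow_neg_mul_sq_le (hσ1 : σ < 1) (hx : 0 < x) (hxt : x ≤ t) :
    x ^ (-(2 * σ)) * x ^ 2 / t ≤ t ^ (1 - 2 * σ) := by
  have ht : 0 < t := by linarith
  rw [div_le_iff₀ ht, ← Real.rpow_natCast, ← Real.rpow_add hx]
  calc x ^ (-(2 * σ) + ((2 : ℕ) : ℝ)) ≤ t ^ (-(2 * σ) + ((2 : ℕ) : ℝ)) :=
        Real.rpow_le_rpow hx.le hxt (by push_cast; linarith)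
    _ = t ^ (1 - 2 * σ) * t := by
        rw [← Real.rpow_add_one ht.ne']
        congr 1
        push_cast
        ring

lemma norm_partsCoeff_le (hσ : 0 < σ) (hσ1 : σ < 1) (hm : 0 < m) (hx : 1 ≤ x) (hmx : m ≤ x)
    (htx : t * m ≤ x ^ 2) (hxt : x ≤ t) :
    ‖partsCoeff σ t m x‖ ≤ 12 * (t ^ (1 - 2 * σ) / m) := by
  have hx0 : 0 < x := by linarith
  have ht : 0 < t := by linarith
  rw [partsCoeff, norm_mul, Complex.norm_of_nonneg (weight_nonneg hm hx0)]
  calc _ ≤ x ^ (-(2 * σ)) * (12 * x ^ 2 / (t * m)) := by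
        gcongr
        · exact weight_le hσ hm hx0
        · exact norm_recipIncrement_le ht hm hx hmx htx
    _ = 12 * ((x ^ (-(2 * σ)) * x ^ 2 / t) / m) := by field_simp
    _ ≤ _ := by
        gcongr
        exact rpow_neg_mul_sq_le hσ1 hx0 hxt

lemma norm_partsCoeff_sub_le (hσ : 0 < σ) (hσ1 : σ < 1) (hm : 0 < m) (hx : 1 ≤ x) (hmx : m ≤ x)
    (htx : t * m ≤ x ^ 2) (hxt : x ≤ t) :
    ‖partsCoeff σ t m (x + 1) - partsCoeff σ t m x‖ ≤ 2904 * (t ^ (1 - 2 * σ) / m) * x⁻¹ := by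
  have hx0 : 0 < x := by linarith
  have ht : 0 < t := by linarith
  have hw := weight_le hσ hm hx0
  have h1 := abs_weight_sub_le hσ hσ1.le hm hx0
  have h2 := norm_recipIncrement_le ht hm hx hmx htx
  have h3 := norm_recipIncrement_sub_le ht hm hx hmx htx
  have heq : partsCoeff σ t m (x + 1) - partsCoeff σ t m x
      = ((weight σ m (x + 1) - weight σ m x : ℝ) : ℂ) * recipIncrement t m x
        + (weight σ m (x + 1) : ℂ) * (recipIncrement t m (x + 1) - recipIncrement t m x) := by
    unfold partsCoeff
    push_cast
    ring
  rw [heq]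
  refine (norm_add_le _ _).trans ?_
  rw [norm_mul, norm_mul, Complex.norm_real, Real.norm_eq_abs,
    Complex.norm_of_nonneg (weight_nonneg hm (by linarith))]
  calc _ ≤ 2 * x ^ (-(2 * σ)) / x * (12 * x ^ 2 / (t * m))
        + x ^ (-(2 * σ)) * (2880 * x / (t * m)) := by
        gcongr
        · exact h1.trans (by gcongr)
        · exact (weight_succ_le hσ hm hx0).trans hw
    _ = 2904 * ((x ^ (-(2 * σ)) * x ^ 2 / t) / m) * x⁻¹ := by field_simp; norm_num
    _ ≤ _ := by
        gcongr
        exact rpow_neg_mul_sq_le hσ1 hx0 hxt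

end PartsCoeff

/-! ### The oscillating sum for fixed `m`. -/

lemma sum_inv_le_one_add_log {s : Finset ℕ} {y : ℝ} (hy : 1 ≤ y)
    (hs : ∀ n ∈ s, 1 ≤ n ∧ (n : ℝ) ≤ y) :
    ∑ n ∈ s, (n : ℝ)⁻¹ ≤ 1 + Real.log y := by
  have hfl : 0 < ⌊y⌋₊ := Nat.floor_pos.mpr hy
  have hsub : s ⊆ Finset.Icc 1 ⌊y⌋₊ := fun n hn =>
    Finset.mem_Icc.mpr ⟨(hs n hn).1, Nat.le_floor (hs n hn).2⟩
  calc ∑ n ∈ s, (n : ℝ)⁻¹ ≤ ∑ n ∈ Finset.Icc 1 ⌊y⌋₊, (n : ℝ)⁻¹ :=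
        Finset.sum_le_sum_of_subset_of_nonneg hsub fun n _ _ => by positivity
    _ = (harmonic ⌊y⌋₊ : ℝ) := by rw [harmonic_eq_sum_Icc]; push_cast; rfl
    _ ≤ 1 + Real.log ⌊y⌋₊ := harmonic_le_one_add_log _
    _ ≤ 1 + Real.log y := by
        gcongr
        exact Nat.floor_le (by linarith)

/-- The oscillating factor `(1 + m / n) ^ (i t)`. -/
noncomputable def oscFactor (t : ℝ) (m n : ℕ) : ℂ :=
  Complex.exp (Complex.I * ((t * (Real.log (n + m) - Real.log n) : ℝ) : ℂ))

lemma norm_oscFactor (t : ℝ) (m n : ℕ) : ‖oscFactor t m n‖ = 1 :=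
  Complex.norm_exp_I_mul_ofReal _

lemma summand_eq {σ t : ℝ} {m n : ℕ} (hn : 1 ≤ n) :
    1 / ((n : ℂ) ^ ((σ : ℂ) + t * Complex.I) *
        ((n : ℂ) + (m : ℂ)) ^ (starRingEnd ℂ ((σ : ℂ) + t * Complex.I)))
      = (weight σ m n : ℂ) * oscFactor t m n := by
  have hn0 : (0 : ℝ) < n := by exact_mod_cast hn
  have hnm : (0 : ℝ) < (n : ℝ) + m := by positivity
  have hc : ∀ (y : ℝ) (w : ℂ), 0 < y → (y : ℂ) ^ w = Complex.exp (Real.log y * w) := by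
    intro y w hy
    rw [Complex.cpow_def_of_ne_zero (by exact_mod_cast hy.ne'), Complex.ofReal_log hy.le]
  have h1 := hc n ((σ : ℂ) + t * Complex.I) hn0
  have h2 := hc (n + m) (starRingEnd ℂ ((σ : ℂ) + t * Complex.I)) hnm
  push_cast at h1 h2
  rw [h1, h2, ← Complex.exp_add, one_div, ← Complex.exp_neg, weight, oscFactor,
    Real.rpow_def_of_pos hn0, Real.rpow_def_of_pos hnm, ← Real.exp_add, Complex.ofReal_exp,
    ← Complex.exp_add]
  congr 1
  simp only [map_add, map_mul, Complex.conj_ofReal, Complex.conj_I]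
  push_cast
  ring

lemma partsCoeff_mul_oscFactor_sub {σ t : ℝ} {m n : ℕ} (ht : 0 < t) (hm : 1 ≤ m) (hn : 1 ≤ n)
    (hmn : m ≤ n) (htn : t * m ≤ (n : ℝ) ^ 2) :
    partsCoeff σ t m n * (oscFactor t m (n + 1) - oscFactor t m n)
      = (weight σ m n : ℂ) * oscFactor t m n := by
  have hm0 : (0 : ℝ) < m := by exact_mod_cast hm
  have hn1 : (1 : ℝ) ≤ n := by exact_mod_cast hn
  have hne := increment_ne_zero ht hm0 hn1 (by exact_mod_cast hmn) htn
  have hz : oscFactor t m (n + 1) = oscFactor t m n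
      * Complex.exp (Complex.I * ((-(t * logStep m n) : ℝ) : ℂ)) := by
    rw [oscFactor, oscFactor, ← Complex.exp_add, logStep_eq hm0 (by linarith)]
    congr 1
    push_cast
    ring
  rw [hz, partsCoeff, recipIncrement]
  field_simp

lemma norm_sum_weight_oscFactor_le {σ t : ℝ} {m B M : ℕ} (hσ : 0 < σ) (hσ1 : σ < 1)
    (ht : 1 ≤ t) (hm : 1 ≤ m) (hB : 1 ≤ B) (hmB : m ≤ B) (htB : t * m ≤ (B : ℝ) ^ 2)
    (hMt : (M : ℝ) ≤ t) :
    ‖∑ n ∈ Finset.Ico B M, (weight σ m n : ℂ) * oscFactor t m n‖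
      ≤ 2928 * (t ^ (1 - 2 * σ) / m) * (1 + Real.log t) := by
  have hlog := Real.log_nonneg ht
  have ht0 : 0 < t := by linarith
  rcases le_or_gt B M with hBM | hBM
  swap
  · rw [Finset.Ico_eq_empty (by omega), Finset.sum_empty, norm_zero]
    positivity
  have hm0 : (0 : ℝ) < m := by exact_mod_cast hm
  have hcond : ∀ n, B ≤ n → (1 : ℝ) ≤ n ∧ (m : ℝ) ≤ n ∧ t * m ≤ (n : ℝ) ^ 2 := by
    intro n hn
    refine ⟨by exact_mod_cast hB.trans hn, by exact_mod_cast hmB.trans hn, htB.trans ?_⟩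
    gcongr
  have hle : ∀ n, n ≤ M → (n : ℝ) ≤ t := fun n hn => le_trans (by exact_mod_cast hn) hMt
  have hend : ∀ n, B ≤ n → n ≤ M → ‖partsCoeff σ t m n‖ ≤ 12 * (t ^ (1 - 2 * σ) / m) := by
    intro n h1 h2
    obtain ⟨a, b, c⟩ := hcond n h1
    exact norm_partsCoeff_le hσ hσ1 hm0 a b c (hle n h2)
  have hsum : ∑ n ∈ Finset.Ico B M, ‖partsCoeff σ t m ((n + 1 : ℕ) : ℝ) - partsCoeff σ t m n‖
      ≤ 2904 * (t ^ (1 - 2 * σ) / m) * (1 + Real.log t) := by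
    calc _ ≤ ∑ n ∈ Finset.Ico B M, 2904 * (t ^ (1 - 2 * σ) / m) * (n : ℝ)⁻¹ := by
          refine Finset.sum_le_sum fun n hn => ?_
          obtain ⟨h1, h2⟩ := Finset.mem_Ico.mp hn
          obtain ⟨a, b, c⟩ := hcond n h1
          push_cast
          exact norm_partsCoeff_sub_le hσ hσ1 hm0 a b c (hle n h2.le)
      _ ≤ _ := by
          rw [← Finset.mul_sum]
          gcongr
          refine sum_inv_le_one_add_log ht fun n hn => ?_
          obtain ⟨h1, h2⟩ := Finset.mem_Ico.mp hn
          exact ⟨hB.trans h1, hle n h2.le⟩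
  have heq : ∑ n ∈ Finset.Ico B M, (weight σ m n : ℂ) * oscFactor t m n
      = ∑ n ∈ Finset.Ico B M,
        partsCoeff σ t m n * (oscFactor t m (n + 1) - oscFactor t m n) := by
    refine Finset.sum_congr rfl fun n hn => ?_
    have h1 := (Finset.mem_Ico.mp hn).1
    exact (partsCoeff_mul_oscFactor_sub ht0 hm (hB.trans h1) (hmB.trans h1)
      (hcond n h1).2.2).symm
  have hK : 0 ≤ t ^ (1 - 2 * σ) / m := by positivity
  rw [heq]
  refine (norm_sum_mul_sub_le (fun n : ℕ => partsCoeff σ t m n) (oscFactor t m)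
    (fun n => (norm_oscFactor t m n).le) hBM).trans ?_
  have h1 := hend M hBM le_rfl
  have h2 := hend B le_rfl hBM
  -- The constant is `2928 = 12 + 12 + 2904`: two endpoints and the total variation.
  nlinarith

/-! ### The interchange of sums and the final bound. -/

lemma norm_doubleSumS₂_le {σ δ t : ℝ} (hσ : 0 < σ) (hσ1 : σ < 1) (hδ : δ < 1 / 4)
    (ht : 16 ≤ t) :
    ‖doubleSumS₂ σ t δ‖ ≤ 2928 * t ^ (1 - 2 * σ) * (1 + Real.log t) ^ 2 := by
  have ht0 : 0 < t := by linarith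
  have ht1 : 1 ≤ t := by linarith
  have hlog := Real.log_nonneg ht1
  set Y : ℝ := t ^ (1 - δ) with hY
  set N : ℕ := ⌊t / (2 * Real.pi)⌋₊ with hN
  -- Here `δ < 1 / 4` enters: `Y ^ 2 ≥ t ^ (3 / 2) ≥ 4 * t`.
  have hYsq : 2 * t ≤ Y ^ 2 := by
    have h4 : (4 : ℝ) ≤ t ^ (1 / 2 : ℝ) := by
      rw [← Real.sqrt_eq_rpow]
      exact Real.le_sqrt_of_sq_le (by linarith)
    have : t ^ (3 / 2 : ℝ) ≤ Y ^ 2 := by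
      rw [hY, ← Real.rpow_natCast, ← Real.rpow_mul ht0.le]
      exact Real.rpow_le_rpow_of_exponent_le ht1 (by push_cast; linarith)
    have h32 : t ^ (3 / 2 : ℝ) = t * t ^ (1 / 2 : ℝ) := by
      rw [← Real.rpow_one_add' ht0.le (by norm_num)]
      norm_num
    nlinarith
  have hYpos : 0 < Y := Real.rpow_pos_of_pos ht0 _
  have hY2 : 2 ≤ Y := by nlinarith
  have hX : 0 < Y - 1 := by linarith
  -- Summation by parts also evaluates the coefficient at the excluded endpoint `N + 1`.
  have hNt : ((N + 1 : ℕ) : ℝ) ≤ t := by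
    have h1 : (N : ℝ) ≤ t / (2 * Real.pi) := Nat.floor_le (by positivity)
    have h2 : t / (2 * Real.pi) ≤ t / 6 := by
      gcongr
      linarith [Real.pi_gt_three]
    push_cast
    linarith
  -- `B m` is the least `n` admissible for `m`; the `+ 1` encodes the strict inequality.
  set B : ℕ → ℕ := fun m => max ⌈Y⌉₊ (⌊(m : ℝ) * (Y - 1)⌋₊ + 1) with hBdef
  have hrow : ∀ m n : ℕ, (B m ≤ n ↔ Y ≤ n ∧ (m : ℝ) < n / (Y - 1)) := by
    intro m n
    rw [hBdef, max_le_iff, Nat.ceil_le, Nat.add_one_le_iff, Nat.floor_lt (by positivity),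
      lt_div_iff₀ hX]
  have hswap : doubleSumS₂ σ t δ
      = ∑ m ∈ Finset.Ico 1 ⌈(N : ℝ) / (Y - 1)⌉₊, ∑ n ∈ Finset.Ico (B m) (N + 1),
        (weight σ m n : ℂ) * oscFactor t m n := by
    have hsw : doubleSumS₂ σ t δ
        = ∑ m ∈ Finset.Ico 1 ⌈(N : ℝ) / (Y - 1)⌉₊, ∑ n ∈ Finset.Ico (B m) (N + 1),
        1 / ((n : ℂ) ^ ((σ : ℂ) + t * Complex.I) *
        ((n : ℂ) + (m : ℂ)) ^ (starRingEnd ℂ ((σ : ℂ) + t * Complex.I))) := by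
      unfold doubleSumS₂
      refine Finset.sum_comm' fun n m => ?_
      simp only [Finset.mem_Icc, Finset.mem_Ico, Nat.lt_ceil, Nat.ceil_le, hrow,
        Nat.lt_add_one_iff]
      constructor
      · rintro ⟨⟨h1, h2⟩, h3, h4⟩
        refine ⟨⟨⟨h1, h4⟩, h2⟩, h3, h4.trans_le ?_⟩
        gcongr
      · rintro ⟨⟨⟨h1, h4⟩, h2⟩, h3, -⟩
        exact ⟨⟨h1, h2⟩, h3, h4⟩
    rw [hsw]
    refine Finset.sum_congr rfl fun m _ => Finset.sum_congr rfl fun n hn => ?_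
    have h1 := ((hrow m n).mp (Finset.mem_Ico.mp hn).1).1
    have h2 : (1 : ℝ) ≤ n := by linarith
    exact summand_eq (by exact_mod_cast h2)
  have hinner : ∀ m ∈ Finset.Ico 1 ⌈(N : ℝ) / (Y - 1)⌉₊,
      ‖∑ n ∈ Finset.Ico (B m) (N + 1), (weight σ m n : ℂ) * oscFactor t m n‖
      ≤ 2928 * t ^ (1 - 2 * σ) * (1 + Real.log t) * (m : ℝ)⁻¹ := by
    intro m hm
    have hm1 := (Finset.mem_Ico.mp hm).1
    obtain ⟨h1, h2⟩ := (hrow m (B m)).mp le_rfl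
    rw [lt_div_iff₀ hX] at h2
    have hB1 : (1 : ℝ) ≤ B m := by linarith
    have hm0 : (0 : ℝ) < m := by exact_mod_cast hm1
    have hmB : (m : ℝ) ≤ B m := by nlinarith
    -- The non-resonance condition: one factor `B m` is bounded below by `Y`, the other by `m * (Y -
    -- 1)`.
    have htB : t * m ≤ (B m : ℝ) ^ 2 := by
      have h3 : t ≤ Y * (Y - 1) := by nlinarith
      calc t * m ≤ Y * (Y - 1) * m := by gcongr
        _ = Y * (m * (Y - 1)) := by ring
        _ ≤ B m * B m := by gcongr
        _ = _ := by ring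
    refine (norm_sum_weight_oscFactor_le hσ hσ1 ht1 hm1 (by exact_mod_cast hB1)
      (by exact_mod_cast hmB) htB hNt).trans (le_of_eq ?_)
    field_simp
  rw [hswap]
  calc _ ≤ ∑ m ∈ Finset.Ico 1 ⌈(N : ℝ) / (Y - 1)⌉₊,
        2928 * t ^ (1 - 2 * σ) * (1 + Real.log t) * (m : ℝ)⁻¹ := norm_sum_le_of_le _ hinner
    _ ≤ 2928 * t ^ (1 - 2 * σ) * (1 + Real.log t) * (1 + Real.log t) := by
        rw [← Finset.mul_sum]
        gcongr
        refine sum_inv_le_one_add_log ht1 fun m hm => ?_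
        obtain ⟨h1, h2⟩ := Finset.mem_Ico.mp hm
        refine ⟨h1, ?_⟩
        rw [Nat.lt_ceil] at h2
        have h3 : (N : ℝ) / (Y - 1) ≤ N := div_le_self (by positivity) (by linarith)
        push_cast at hNt
        linarith
    _ = _ := by ring

theorem lemmal7p5 :
    ∃ δ₀ : ℝ, 0 < δ₀ ∧ ∀ δ : ℝ, 0 < δ → δ < δ₀ → ∀ σ : ℝ, 0 < σ → σ < 1 →
      ∃ E₁ E₂ : ℝ → ℂ,
        (∀ t : ℝ, 0 < t → doubleSumS₂ σ t δ = E₁ t + E₂ t) ∧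
        E₁ =O[atTop] (fun t : ℝ => t ^ (1 - 2 * σ + 2 * δ * σ) * Real.log t ^ 3) ∧
        E₂ =O[atTop] (fun t : ℝ => t ^ δ / t ^ (2 * σ)) := by
  -- The whole sum is absorbed by the first error term, with slack `t ^ (2 * δ * σ)` and a spare
  -- logarithm.
  refine ⟨1 / 4, by norm_num, fun δ hδ hδ' σ hσ hσ1 =>
    ⟨fun t => doubleSumS₂ σ t δ, 0, fun t _ => by simp, ?_, isBigO_zero _ _⟩⟩
  refine IsBigO.of_bound (2928 * 4) ?_
  filter_upwards [eventually_ge_atTop (16 : ℝ)] with t ht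
  have hlog : 1 ≤ Real.log t := by
    rw [Real.le_log_iff_exp_le (by linarith)]
    linarith [Real.exp_one_lt_d9]
  have ht0 : 0 < t := by linarith
  have hpow : t ^ (1 - 2 * σ) ≤ t ^ (1 - 2 * σ + 2 * δ * σ) := by
    refine Real.rpow_le_rpow_of_exponent_le (by linarith) ?_
    have : 0 ≤ 2 * δ * σ := by positivity
    linarith
  have hlog3 : (1 + Real.log t) ^ 2 ≤ 4 * Real.log t ^ 3 := by
    calc (1 + Real.log t) ^ 2 ≤ (2 * Real.log t) ^ 2 := by gcongr; linarith
      _ = 4 * Real.log t ^ 2 := by ring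
      _ ≤ 4 * Real.log t ^ 3 := by gcongr; norm_num
  rw [Real.norm_of_nonneg (by positivity)]
  calc ‖doubleSumS₂ σ t δ‖ ≤ 2928 * t ^ (1 - 2 * σ) * (1 + Real.log t) ^ 2 :=
        norm_doubleSumS₂_le hσ hσ1 hδ' ht
    _ ≤ 2928 * t ^ (1 - 2 * σ + 2 * δ * σ) * (4 * Real.log t ^ 3) := by gcongr
    _ = _ := by ring
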